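/- Let $\Gamma$ be a finite simple graph that is biregular, i.e. exactly two distinct valencies occur, and let $V_1,V_2$ be the two classes of vertices of equal valency. Suppose that the subgraph $\Gamma_1$ induced on $V_1$ is empty, and that the edges between $V_1$ and $V_2$ form the incidence relation of a quasi-symmetric design with point set $V_1$ and block set $V_2$. That is, there are integers $v,k,\lambda,x,y$ with $|V_1|=v$, $2\le k\le v$, $\lambda\ge 1$, $x\ne y$ such that each block is incident with exactly $k$ points, any two distinct points are incident with exactly $\lambda$ common blocks, and the number of points common to two distinct blocks is always $x$ or $y$, both values being attained (repeated blocks are allowed, and $x<y$ is not required). Suppose further that the subgraph $\Gamma_2$ induced on $V_2$ is the block graph of this design, in which two distinct blocks are adjacent if and only if they have exactly $y$ common points. Put $$r=\lambda\frac{v-1}{k-1},\quad b=\frac{vr}{k},\quad a=\frac{(r-1)k-x(b-1)}{y-x},\quad \rho_1=\frac{r-\lambda-k+x}{y-x},\quad \rho_2=\frac{x-k}{y-x},$$ $$d=a+\rho_1\rho_2,\qquad c=d+\rho_1+\rho_2$$ (so that $r$ is the replication number of the design, $b=|V_2|$, and $\Gamma_2$ is strongly regular with parameters $(b,a,c,d)$).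 Let $\mathcal L$ be the normalized Laplacian matrix of $\Gamma$: with $d_u$ the valency of $u$, $\mathcal L_{uu}=1$ if $d_u\neq 0$, $\mathcal L_{uw}=-1/\sqrt{d_ud_w}$ if $u$ and $w$ are adjacent, and all other entries are $0$. Then for all real numbers $\theta_1,\theta_2$ the following are equivalent: $0,\theta_1,\theta_2$ are pairwise distinct and the set of eigenvalues of $\mathcal L$ is $\{0,\theta_1,\theta_2\}$; and the following seven equations hold: $$\begin{array}{rcl} \frac{r}{k+a}&=&tr^2-(\theta_1-1)(\theta_2-1)r,\\ \frac{\lambda}{k+a}&=&tr^2,\\ \frac kr+\frac{a}{k+a}&=&t(k+a)^2-(\theta_1-1)(\theta_2-1)(k+a),\\ \frac{x}{r}+\frac{d}{k+a}&=&t(k+a)^2,\\ \frac{y}{r}+\frac{c}{k+a}&=&t(k+a)^2+2-\theta_1-\theta_2,\\ \frac{\lambda k-xr}{(y-x)(k+a)}&=&tr(k+a),\\ \frac{(\lambda-1)(k-1)-(x-1)(r-1)}{(y-x)(k+a)}&=&tr(k+a)+2-\theta_1-\theta_2, \end{array}$$ where $t=\dfrac{\theta_1\theta_2}{vr+b(k+a)}$.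 -/

import Mathlib

/-- The normalized Laplacian matrix of a finite simple graph: the diagonal entry at `u` is `1` if
`u` is not isolated, the entry at adjacent `u, w` is `-1 / √(d_u d_w)`, all other entries are `0`. -/
noncomputable def normalizedLaplacian {V : Type*} [Fintype V] [DecidableEq V]
    (G : SimpleGraph V) [DecidableRel G.Adj] : Matrix V V ℝ :=
  Matrix.of fun u w =>
    if u = w ∧ G.degree u ≠ 0 then 1
    else if G.Adj u w then -1 / Real.sqrt ((G.degree u : ℝ) * (G.degree w : ℝ))
    else 0

/-- The distinct eigenvalues of the normalized Laplacian of `G` are exactly the three (pairwise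
different) numbers `0, θ₁, θ₂`. -/
def HasThreeLEigenvalues {V : Type*} [Fintype V] [DecidableEq V]
    (G : SimpleGraph V) [DecidableRel G.Adj] (θ₁ θ₂ : ℝ) : Prop :=
  θ₁ ≠ 0 ∧ θ₂ ≠ 0 ∧ θ₁ ≠ θ₂ ∧ spectrum ℝ (normalizedLaplacian G) = {0, θ₁, θ₂}

/-- `G` is biregular (exactly two distinct valencies occur) and `V₁, V₂` are its two valency
classes. -/
def IsBiregularWithPartition {V : Type*} [Fintype V]
    (G : SimpleGraph V) [DecidableRel G.Adj] (V₁ V₂ : Set V) : Prop :=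
  V₁.Nonempty ∧ V₂.Nonempty ∧ V₁ ∪ V₂ = Set.univ ∧
    ∃ k₁ k₂ : ℕ, k₁ ≠ k₂ ∧ V₁ = {u | G.degree u = k₁} ∧ V₂ = {u | G.degree u = k₂}

/-- The incidence relation `I` between points and blocks is that of a `2`-`(v, k, lam)` design.
Different blocks may be incident with the same points (repeated blocks). -/
structure IsTwoDesign {P B : Type*} (I : P → B → Prop) (v k lam : ℕ) : Prop where
  finite_points : Finite P
  finite_blocks : Finite B
  card_points : Nat.card P = v
  two_le_k : 2 ≤ k
  k_le_v : k ≤ v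
  lam_pos : 0 < lam
  card_block : ∀ β : B, {p : P | I p β}.ncard = k
  card_blocks_through : ∀ p q : P, p ≠ q → {β : B | I p β ∧ I q β}.ncard = lam

/-- A quasi-symmetric `2`-`(v, k, lam)` design: two different blocks meet in `x` or in `y` points,
where `x ≠ y` and both intersection sizes occur. The order of `x` and `y` is not prescribed. -/
structure IsQuasiSymmetricDesign {P B : Type*} (I : P → B → Prop) (v k lam x y : ℕ) : Prop
    extends IsTwoDesign I v k lam where
  x_ne_y : x ≠ y
  inter : ∀ β γ : B, β ≠ γ →
    {p : P | I p β ∧ I p γ}.ncard = x ∨ {p : P | I p β ∧ I p γ}.ncard = y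
  exists_x : ∃ β γ : B, β ≠ γ ∧ {p : P | I p β ∧ I p γ}.ncard = x
  exists_y : ∃ β γ : B, β ≠ γ ∧ {p : P | I p β ∧ I p γ}.ncard = y

/-- The block graph: two different blocks are adjacent if they meet in `y` points. -/
def blockGraph {P B : Type*} (I : P → B → Prop) (y : ℕ) : SimpleGraph B where
  Adj β γ := β ≠ γ ∧ {p : P | I p β ∧ I p γ}.ncard = y
  symm := ⟨fun β γ h => ⟨h.1.symm, by simpa only [and_comm] using h.2⟩⟩
  loopless := ⟨fun _ h => h.1 rfl⟩

/-- The relation between `V₁` (points) and `V₂` (blocks) given by the edges of `G`. -/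
def edgeIncidence {V : Type*} (G : SimpleGraph V) (V₁ V₂ : Set V) : V₁ → V₂ → Prop :=
  fun p β => G.Adj (p : V) (β : V)

/-! For a connected graph the kernel of the normalized Laplacian `L` is spanned by the vector of
square roots of the valencies. Let `E` be the orthogonal projection onto it. If the eigenvalues are
0, θ₁, θ₂, then `(L - θ₁)(L - θ₂)` is killed by `L`, hence equals `θ₁θ₂E`. Conversely this identity,
with θ₁ and θ₂ nonzero, gives that spectrum unless `L = θ(1 - E)`, which a nonadjacent pair of
vertices rules out. Rescaled by square roots of valencies, the identity is a condition on each entry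
of `A D⁻¹ A` (`hasThreeLEigenvalues_iff`).

Here an entry depends only on the type of the pair: equal or distinct points, equal, nonadjacent or
adjacent blocks, a nonincident or incident point and block. The Gram matrices of the design,
together with `sum_incidence_mul_adj` and `sum_adj_mul_adj`, give the seven values. All seven types
occur, so the condition is exactly the seven equations. -/

/-! ### Spectral theory of the normalized Laplacian -/

/-- A real symmetric matrix is annihilated by every polynomial vanishing on its spectrum; the cubic
case with the roots `0, θ₁, θ₂`. -/
theorem mul_sub_mul_sub_eq_zero_of_spectrum {V : Type*} [Fintype V] [DecidableEq V]
    {L : Matrix V V ℝ} (hL : L.IsHermitian) {θ₁ θ₂ : ℝ} (h : spectrum ℝ L = {0, θ₁, θ₂}) :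
    L * ((L - θ₁ • 1) * (L - θ₂ • 1)) = 0 := by
  have hsa : IsSelfAdjoint L := hL
  have h1 := cfc_polynomial (R := ℝ) (a := L) (Polynomial.X * ((Polynomial.X - Polynomial.C θ₁) *
    (Polynomial.X - Polynomial.C θ₂))) hsa
  have h2 : cfc (R := ℝ) (Polynomial.X * ((Polynomial.X - Polynomial.C θ₁) *
    (Polynomial.X - Polynomial.C θ₂))).eval L = cfc (R := ℝ) (fun _ => (0 : ℝ)) L := by
    apply cfc_congr
    intro z hz
    rw [h] at hz
    rcases hz with rfl | rfl | rfl <;> simp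
  rw [h2, cfc_const_zero] at h1
  simpa [Algebra.algebraMap_eq_smul_one] using h1.symm

theorem normalizedLaplacian_apply {V : Type*} [Fintype V] [DecidableEq V]
    (G : SimpleGraph V) [DecidableRel G.Adj] (hdeg : ∀ u, 0 < G.degree u) (u w : V) :
    normalizedLaplacian G u w = (if u = w then 1 else 0) -
      (G.adjMatrix ℝ u w) / (√(G.degree u) * √(G.degree w)) := by
  simp only [normalizedLaplacian, Matrix.of_apply, SimpleGraph.adjMatrix_apply]
  by_cases h : u = w
  · subst h
    simp [(hdeg u).ne']
  · by_cases h2 : G.Adj u w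
    · simp [h, h2, neg_div]
    · simp [h, h2]

theorem normalizedLaplacian_isHermitian {V : Type*} [Fintype V] [DecidableEq V]
    (G : SimpleGraph V) [DecidableRel G.Adj] : (normalizedLaplacian G).IsHermitian := by
  ext u w
  simp only [Matrix.conjTranspose_apply, normalizedLaplacian, Matrix.of_apply, star_trivial,
    G.adj_comm w u, mul_comm (G.degree w : ℝ)]
  by_cases h : u = w
  · subst h; rfl
  · simp [h, Ne.symm h]

/-- The vector of square roots of the degrees is in the kernel. -/
theorem normalizedLaplacian_mulVec_sqrt {V : Type*} [Fintype V] [DecidableEq V]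
    (G : SimpleGraph V) [DecidableRel G.Adj] (hdeg : ∀ u, 0 < G.degree u) :
    (normalizedLaplacian G).mulVec (fun u => √(G.degree u)) = 0 := by
  ext u
  have hpos : ∀ u, 0 < √(G.degree u : ℝ) := fun u => Real.sqrt_pos.2 (by exact_mod_cast hdeg u)
  have h1 : ∀ w, normalizedLaplacian G u w * √(G.degree w) =
      (if u = w then √(G.degree w : ℝ) else 0) - G.adjMatrix ℝ u w / √(G.degree u) := by
    intro w
    rw [normalizedLaplacian_apply G hdeg, sub_mul, ite_mul, one_mul, zero_mul]
    have := (hpos w).ne'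
    have := (hpos u).ne'
    field_simp
  have h2 : ∑ w, G.adjMatrix ℝ u w = G.degree u := by
    simp only [SimpleGraph.adjMatrix_apply]
    exact (G.degree_eq_sum_if_adj u).symm
  simp only [Matrix.mulVec, dotProduct, h1, Finset.sum_sub_distrib, ← Finset.sum_div, h2]
  simp

/-- The kernel of the normalized Laplacian of a connected graph is spanned by the square roots of
the degrees. -/
theorem exists_eq_smul_sqrt_of_mulVec_eq_zero {V : Type*} [Fintype V] [DecidableEq V]
    (G : SimpleGraph V) [DecidableRel G.Adj] (hdeg : ∀ u, 0 < G.degree u) (hconn : G.Connected)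
    (f : V → ℝ) (hf : (normalizedLaplacian G).mulVec f = 0) :
    ∃ α : ℝ, ∀ u, f u = α * √(G.degree u) := by
  have hpos : ∀ u, 0 < √(G.degree u : ℝ) := fun u => Real.sqrt_pos.2 (by exact_mod_cast hdeg u)
  -- The combinatorial Laplacian is `D^(1/2) L D^(1/2)`, so `D^(-1/2) f` lies in its kernel and is
  -- constant on connected components.
  have key : (G.lapMatrix ℝ).mulVec (fun u => f u / √(G.degree u)) = 0 := by
    ext u
    have h0 := congrFun hf u
    simp only [Matrix.mulVec, dotProduct, Pi.zero_apply] at h0 ⊢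
    have h1 : ∀ w, G.lapMatrix ℝ u w * (f w / √(G.degree w)) =
        √(G.degree u) * (normalizedLaplacian G u w * f w) := by
      intro w
      have hu := (hpos u).ne'
      have hw := (hpos w).ne'
      rw [normalizedLaplacian_apply G hdeg, SimpleGraph.lapMatrix, Matrix.sub_apply,
        SimpleGraph.degMatrix, Matrix.diagonal_apply]
      by_cases h : u = w
      · subst h
        have := Real.mul_self_sqrt (Nat.cast_nonneg (α := ℝ) (G.degree u))
        simp only [if_true, SimpleGraph.adjMatrix_apply, SimpleGraph.irrefl, if_false, zero_div,
          sub_zero, one_mul]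
        field_simp
        linear_combination -f u * this
      · simp only [h, if_false]
        field_simp
        ring
    simp only [h1, ← Finset.mul_sum, h0, mul_zero]
  rw [SimpleGraph.lapMatrix_mulVec_eq_zero_iff_forall_reachable] at key
  obtain ⟨u₀⟩ := hconn.nonempty
  refine ⟨f u₀ / √(G.degree u₀), fun u => ?_⟩
  rw [← key u u₀ (hconn.preconnected u u₀)]
  field_simp [(hpos u).ne']

/-- Entries of `(L - θ₁)(L - θ₂)`, rescaled by the square roots of the degrees. -/
theorem normalizedLaplacian_quadratic_apply {V : Type*} [Fintype V] [DecidableEq V]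
    (G : SimpleGraph V) [DecidableRel G.Adj] (hdeg : ∀ u, 0 < G.degree u) (θ₁ θ₂ : ℝ) (u w : V) :
    ((normalizedLaplacian G - θ₁ • 1) * (normalizedLaplacian G - θ₂ • 1)) u w *
        (√(G.degree u) * √(G.degree w)) =
      ∑ z, G.adjMatrix ℝ u z * G.adjMatrix ℝ z w / G.degree z -
        (2 - θ₁ - θ₂) * G.adjMatrix ℝ u w +
        (if u = w then (θ₁ - 1) * (θ₂ - 1) * G.degree u else 0) := by
  have hpos : ∀ u, 0 < √(G.degree u : ℝ) := fun u => Real.sqrt_pos.2 (by exact_mod_cast hdeg u)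
  have hsq : ∀ u, √(G.degree u : ℝ) * √(G.degree u : ℝ) = G.degree u :=
    fun u => Real.mul_self_sqrt (Nat.cast_nonneg _)
  set N : Matrix V V ℝ := Matrix.of fun u w =>
    G.adjMatrix ℝ u w / (√(G.degree u) * √(G.degree w)) with hN
  have hL : normalizedLaplacian G = 1 - N := by
    ext u w
    rw [normalizedLaplacian_apply G hdeg, Matrix.sub_apply, Matrix.one_apply]; rfl
  have hexp : (normalizedLaplacian G - θ₁ • 1) * (normalizedLaplacian G - θ₂ • 1) =
      N * N - (2 - θ₁ - θ₂) • N + ((θ₁ - 1) * (θ₂ - 1)) • (1 : Matrix V V ℝ) := by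
    rw [hL]
    simp only [sub_mul, mul_sub, one_mul, mul_one, smul_mul_assoc, mul_smul_comm]
    module
  have hNN : (N * N) u w * (√(G.degree u) * √(G.degree w)) =
      ∑ z, G.adjMatrix ℝ u z * G.adjMatrix ℝ z w / G.degree z := by
    rw [Matrix.mul_apply, Finset.sum_mul]
    refine Finset.sum_congr rfl fun z _ => ?_
    have h1 := (hpos u).ne'
    have h2 := (hpos w).ne'
    have h3 := (hpos z).ne'
    simp only [hN, Matrix.of_apply]
    have h4 : (G.degree z : ℝ) ≠ 0 := by exact_mod_cast (hdeg z).ne'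
    have h5 := hsq z
    field_simp
    rw [sq, h5]
    ring
  rw [hexp, Matrix.add_apply, Matrix.sub_apply, add_mul, sub_mul, hNN, Matrix.smul_apply,
    Matrix.smul_apply, Matrix.one_apply]
  congr 1
  · have h1 := (hpos u).ne'
    have h2 := (hpos w).ne'
    simp only [hN, Matrix.of_apply, smul_eq_mul]
    field_simp
  · by_cases h : u = w
    · subst h
      simp [hsq]
    · simp [h]

/-- Given `L * E = E * L = 0` with `E` idempotent and `L, E` real symmetric, the identity
`(L - θ₁)(L - θ₂) = θ₁ θ₂ E` forces the spectrum of `L` to be `{0, θ₁, θ₂}`, unless `L` is a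
multiple of `1 - E`. -/
theorem spectrum_eq_of_quadratic {V : Type*} [Fintype V] [DecidableEq V]
    {L E : Matrix V V ℝ} (hL : L.IsHermitian) (hE : E.IsHermitian) (hLE : L * E = 0)
    (hEE : E * E = E) (hE0 : E ≠ 0) {θ₁ θ₂ : ℝ} (h₁ : θ₁ ≠ 0) (h₂ : θ₂ ≠ 0)
    (hM : (L - θ₁ • 1) * (L - θ₂ • 1) = (θ₁ * θ₂) • E)
    (hne : ∀ θ : ℝ, θ ≠ 0 → L ≠ θ • (1 - E)) :
    θ₁ ≠ θ₂ ∧ spectrum ℝ L = {0, θ₁, θ₂} := by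
  have hEL : E * L = 0 := by
    have := congrArg Matrix.conjTranspose hLE
    rwa [Matrix.conjTranspose_mul, hL.eq, hE.eq, Matrix.conjTranspose_zero] at this
  have hM' : (L - θ₂ • 1) * (L - θ₁ • 1) = (θ₁ * θ₂) • E := by
    rw [← hM]
    simp only [sub_mul, mul_sub, one_mul, mul_one, smul_mul_assoc, mul_smul_comm]
    module
  have hmem : ∀ θ η : ℝ, η ≠ 0 → (L - θ • 1) * (L - η • 1) = (θ * η) • E →
      θ ∈ spectrum ℝ L := by
    intro θ η hη hθη
    rw [spectrum.mem_iff, Algebra.algebraMap_eq_smul_one]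
    intro hu
    rw [← neg_sub, IsUnit.neg_iff] at hu
    apply hne η hη
    -- If `L - θ` were invertible, cancelling it here would give `L = η(1 - E)`, which `hne`
    -- excludes.
    have h0 : (L - θ • 1) * (L - η • (1 - E)) = (L - θ • 1) * 0 := by
      have : (L - θ • 1) * (L - η • (1 - E)) =
          (L - θ • 1) * (L - η • 1) + η • (L * E) - (θ * η) • E := by
        simp only [sub_mul, mul_sub, one_mul, mul_one, smul_mul_assoc, mul_smul_comm, smul_sub]
        module
      rw [this, hθη, hLE, mul_zero, smul_zero, add_zero, sub_self]
    exact sub_eq_zero.1 (hu.mul_left_cancel h0)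
  refine ⟨?_, Set.Subset.antisymm ?_ ?_⟩
  -- For a double root, `L - θ₁(1 - E)` is symmetric with square zero, hence zero.
  · rintro rfl
    apply hne θ₁ h₁
    have hX : (L - θ₁ • (1 - E)).IsHermitian := by
      rw [Matrix.IsHermitian, Matrix.conjTranspose_sub, Matrix.conjTranspose_smul,
        Matrix.conjTranspose_sub, hL.eq, hE.eq, Matrix.conjTranspose_one, star_trivial]
    have h0 : (L - θ₁ • (1 - E)) * (L - θ₁ • (1 - E)) = 0 := by
      have : (L - θ₁ • (1 - E)) * (L - θ₁ • (1 - E)) = (L - θ₁ • 1) * (L - θ₁ • 1)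
          + θ₁ • (L * E) + θ₁ • (E * L) + (θ₁ * θ₁) • (E * E) - (2 * (θ₁ * θ₁)) • E := by
        simp only [sub_mul, mul_sub, one_mul, mul_one, smul_mul_assoc, mul_smul_comm, smul_sub]
        module
      rw [this, hM, hLE, hEL, hEE]
      module
    rw [← sub_eq_zero]
    apply Matrix.conjTranspose_mul_self_eq_zero.1
    rw [hX.eq, h0]
  · intro μ hμ
    by_contra hcon
    simp only [Set.mem_insert_iff, Set.mem_singleton_iff, not_or] at hcon
    obtain ⟨hμ0, hμ1, hμ2⟩ := hcon
    rw [spectrum.mem_iff, Algebra.algebraMap_eq_smul_one] at hμ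
    apply hμ
    set q : ℝ := μ * (μ - θ₁) * (μ - θ₂) with hq
    have hq0 : q ≠ 0 := mul_ne_zero (mul_ne_zero hμ0 (sub_ne_zero.2 hμ1)) (sub_ne_zero.2 hμ2)
    have hcub : L * ((L - θ₁ • 1) * (L - θ₂ • 1)) = 0 := by
      rw [hM, mul_smul_comm, hLE, smul_zero]
    -- The inverse is the divided difference `(f(μ) - f(L)) / (μ - L)` of the cubic `f(z) = z(z -
    -- θ₁)(z - θ₂)`, scaled by `1/f(μ)`; recall `f(L) = 0`.
    refine IsUnit.of_mul_eq_one (q⁻¹ • (L * L + (μ - θ₁ - θ₂) • L +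
      ((μ - θ₁) * (μ - θ₂)) • 1)) ?_
    have : (μ • 1 - L) * (L * L + (μ - θ₁ - θ₂) • L + ((μ - θ₁) * (μ - θ₂)) • 1) =
        q • 1 - L * ((L - θ₁ • 1) * (L - θ₂ • 1)) := by
      simp only [sub_mul, mul_sub, mul_add, one_mul, mul_one, smul_mul_assoc, mul_smul_comm, hq]
      module
    rw [mul_smul_comm, this, hcub, sub_zero, smul_smul, inv_mul_cancel₀ hq0, one_smul]
  · rintro μ (rfl | rfl | rfl)
    · rw [spectrum.mem_iff, Algebra.algebraMap_eq_smul_one, zero_smul, zero_sub, IsUnit.neg_iff]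
      intro hu
      exact hE0 (hu.mul_left_cancel (hLE.trans (mul_zero L).symm))
    · exact hmem μ θ₂ h₂ hM
    · exact hmem μ θ₁ h₁ (by rw [hM', mul_comm])

/-- Characterization of three distinct normalized Laplacian eigenvalues of a connected graph that
is not complete, by the entries of `A D⁻¹ A`. -/
theorem hasThreeLEigenvalues_iff {V : Type*} [Fintype V] [DecidableEq V]
    (G : SimpleGraph V) [DecidableRel G.Adj] (hdeg : ∀ u, 0 < G.degree u) (hconn : G.Connected)
    {u₀ w₀ : V} (hne : u₀ ≠ w₀) (hadj : ¬ G.Adj u₀ w₀) (θ₁ θ₂ : ℝ) :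
    HasThreeLEigenvalues G θ₁ θ₂ ↔ θ₁ ≠ 0 ∧ θ₂ ≠ 0 ∧ ∀ u w,
      ∑ z, G.adjMatrix ℝ u z * G.adjMatrix ℝ z w / G.degree z -
        (2 - θ₁ - θ₂) * G.adjMatrix ℝ u w +
        (if u = w then (θ₁ - 1) * (θ₂ - 1) * G.degree u else 0) =
      θ₁ * θ₂ / (∑ z, (G.degree z : ℝ)) * G.degree u * G.degree w := by
  have hpos : ∀ u, 0 < √(G.degree u : ℝ) := fun u => Real.sqrt_pos.2 (by exact_mod_cast hdeg u)
  have hsq : ∀ u, √(G.degree u : ℝ) * √(G.degree u : ℝ) = G.degree u :=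
    fun u => Real.mul_self_sqrt (Nat.cast_nonneg _)
  have hS : 0 < ∑ z, (G.degree z : ℝ) :=
    Finset.sum_pos (fun z _ => by exact_mod_cast hdeg z) ⟨u₀, Finset.mem_univ _⟩
  set S := ∑ z, (G.degree z : ℝ) with hSdef
  set L := normalizedLaplacian G with hLdef
  have hL : L.IsHermitian := normalizedLaplacian_isHermitian G
  have hLs := normalizedLaplacian_mulVec_sqrt G hdeg
  rw [← hLdef] at hLs
  set E : Matrix V V ℝ := Matrix.of fun u w => √(G.degree u) * √(G.degree w) / S with hEdef
  have hE : E.IsHermitian := by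
    ext u w
    simp [hEdef, mul_comm]
  have hLE : L * E = 0 := by
    ext u w
    have := congrFun hLs u
    simp only [Matrix.mulVec, dotProduct, Pi.zero_apply] at this
    simp only [Matrix.mul_apply, hEdef, Matrix.of_apply, Matrix.zero_apply, mul_div_assoc]
    simp only [← mul_assoc, ← Finset.sum_mul, this, zero_mul]
  have hEL : E * L = 0 := by
    have := congrArg Matrix.conjTranspose hLE
    rwa [Matrix.conjTranspose_mul, hL.eq, hE.eq, Matrix.conjTranspose_zero] at this
  have hEE : E * E = E := by
    ext u w
    have : ∀ z, E u z * E z w = E u w / S * G.degree z := by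
      intro z
      simp only [hEdef, Matrix.of_apply]
      linear_combination (√(G.degree u) * √(G.degree w) / S / S) * hsq z
    rw [Matrix.mul_apply, Finset.sum_congr rfl fun z _ => this z, ← Finset.mul_sum, ← hSdef]
    field_simp
  have hEpos : ∀ u w, 0 < E u w := fun u w => div_pos (mul_pos (hpos u) (hpos w)) hS
  have hentry : ∀ u w, (((L - θ₁ • 1) * (L - θ₂ • 1)) u w = (θ₁ * θ₂) * E u w ↔
      ∑ z, G.adjMatrix ℝ u z * G.adjMatrix ℝ z w / G.degree z -
        (2 - θ₁ - θ₂) * G.adjMatrix ℝ u w +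
        (if u = w then (θ₁ - 1) * (θ₂ - 1) * G.degree u else 0) =
      θ₁ * θ₂ / S * G.degree u * G.degree w) := by
    intro u w
    rw [← normalizedLaplacian_quadratic_apply G hdeg,
      ← mul_left_inj' (mul_pos (hpos u) (hpos w)).ne']
    have : θ₁ * θ₂ * E u w * (√(G.degree u) * √(G.degree w)) =
        θ₁ * θ₂ / S * G.degree u * G.degree w := by
      simp only [hEdef, Matrix.of_apply]
      linear_combination (θ₁ * θ₂ / S * (√(G.degree w) * √(G.degree w))) * hsq u +
        (θ₁ * θ₂ / S * G.degree u) * hsq w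
    rw [this]
  simp only [← hentry]
  have hmat : (∀ u w, ((L - θ₁ • 1) * (L - θ₂ • 1)) u w = (θ₁ * θ₂) * E u w) ↔
      (L - θ₁ • 1) * (L - θ₂ • 1) = (θ₁ * θ₂) • E := by
    rw [← Matrix.ext_iff]; rfl
  rw [hmat]
  constructor
  · rintro ⟨h₁, h₂, h₁₂, hspec⟩
    refine ⟨h₁, h₂, ?_⟩
    have hcub := mul_sub_mul_sub_eq_zero_of_spectrum hL hspec
    have hEM : E * ((L - θ₁ • 1) * (L - θ₂ • 1)) = (θ₁ * θ₂) • E := by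
      have hEθ : ∀ θ : ℝ, E * (L - θ • 1) = (-θ) • E := fun θ => by
        rw [mul_sub, hEL, mul_smul_comm, mul_one, zero_sub, neg_smul]
      rw [← mul_assoc, hEθ, smul_mul_assoc, hEθ, smul_smul, neg_mul_neg]
    set M := (L - θ₁ • 1) * (L - θ₂ • 1) with hMdef
    -- The columns of `M` lie in the kernel of `L`, so `E` fixes them: `M = E M = θ₁θ₂E`.
    have hcol : ∀ w, ∃ α : ℝ, ∀ u, M u w = α * √(G.degree u) := by
      intro w
      apply exists_eq_smul_sqrt_of_mulVec_eq_zero G hdeg hconn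
      ext u
      exact congrFun (congrFun hcub u) w
    rw [← hEM]
    ext u w
    obtain ⟨α, hα⟩ := hcol w
    have : ∀ z, E u z * M z w = α * √(G.degree u) / S * G.degree z := by
      intro z
      simp only [hEdef, Matrix.of_apply, hα]
      linear_combination (α * √(G.degree u) / S) * hsq z
    rw [Matrix.mul_apply, Finset.sum_congr rfl fun z _ => this z, ← Finset.mul_sum, ← hSdef, hα]
    field_simp
  · rintro ⟨h₁, h₂, hM⟩
    have hE0 : E ≠ 0 := fun h => (hEpos u₀ u₀).ne' (congrFun (congrFun h u₀) u₀)
    obtain ⟨h₁₂, hspec⟩ := spectrum_eq_of_quadratic hL hE hLE hEE hE0 h₁ h₂ hM (by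
      -- At a nonadjacent pair of distinct vertices `L` vanishes, while `1 - E` has a negative
      -- entry.
      intro θ hθ hcon
      have h := congrFun (congrFun hcon u₀) w₀
      have hL0 : L u₀ w₀ = 0 := by
        simp [hLdef, normalizedLaplacian, hne, hadj]
      rw [hL0, Matrix.smul_apply, Matrix.sub_apply, Matrix.one_apply_ne hne, zero_sub, smul_eq_mul,
        mul_neg, eq_comm, neg_eq_zero] at h
      exact mul_ne_zero hθ (hEpos _ _).ne' h)
    exact ⟨h₁, h₂, h₁₂, hspec⟩

/-! ### Counting in quasi-symmetric designs -/

/-- `N` is the incidence matrix of a quasi-symmetric design and `B` the adjacency matrix of its block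
graph, expressed by real sums. -/
structure IsQuasiSymmetricPair {P Q : Type*} [Fintype P] [Fintype Q] (N : P → Q → ℝ)
    (B : Q → Q → ℝ) (k lam x y : ℝ) : Prop where
  sq_N : ∀ p β, N p β * N p β = N p β
  sq_B : ∀ β γ, B β γ * B β γ = B β γ
  symm_B : ∀ β γ, B β γ = B γ β
  diag_B : ∀ β, B β β = 0
  sum_points : ∀ β, ∑ p, N p β = k
  sum_blocks_through : ∀ p q, p ≠ q → ∑ β, N p β * N q β = lam
  inter : ∀ β γ, β ≠ γ → ∑ p, N p β * N p γ = x + (y - x) * B β γ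

namespace IsQuasiSymmetricPair

variable {P Q : Type*} [Fintype P] [Fintype Q] {N : P → Q → ℝ} {B : Q → Q → ℝ}
  {k lam x y : ℝ}

/-- Double counting of the pairs `(q, β)` with `p` and `q` both on `β`, including `q = p`. -/
theorem replication [DecidableEq P] (h : IsQuasiSymmetricPair N B k lam x y) (hk : k - 1 ≠ 0)
    (p : P) : ∑ β, N p β = lam * ((Fintype.card P : ℝ) - 1) / (k - 1) := by
  have h1 : ∑ q, ∑ β, N p β * N q β = (∑ β, N p β) * k := by
    rw [Finset.sum_comm, Finset.sum_mul]
    exact Finset.sum_congr rfl fun β _ => by rw [← Finset.mul_sum, h.sum_points]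
  have h2 : ∀ q, ∑ β, N p β * N q β = lam + if p = q then ∑ β, N p β - lam else 0 := by
    intro q
    by_cases hpq : p = q
    · subst hpq
      simp [h.sq_N]
    · simp [hpq, h.sum_blocks_through p q hpq]
  simp only [h2, Finset.sum_add_distrib, Finset.sum_ite_eq, Finset.mem_univ, if_true,
    Finset.sum_const, Finset.card_univ, nsmul_eq_mul] at h1
  rw [eq_div_iff hk]
  linear_combination -h1

variable {r : ℝ}

theorem point_gram [DecidableEq P] (h : IsQuasiSymmetricPair N B k lam x y)
    (hr : ∀ p, ∑ β, N p β = r) (p q : P) :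
    ∑ β, N p β * N q β = lam + if p = q then r - lam else 0 := by
  by_cases hpq : p = q
  · subst hpq
    simp [h.sq_N, hr]
  · simp [hpq, h.sum_blocks_through p q hpq]

theorem block_gram [DecidableEq Q] (h : IsQuasiSymmetricPair N B k lam x y) (β γ : Q) :
    ∑ p, N p β * N p γ = x + (y - x) * B β γ + if β = γ then k - x else 0 := by
  by_cases hpq : β = γ
  · subst hpq
    simp [h.sq_N, h.sum_points, h.diag_B]
  · simp [hpq, h.inter β γ hpq]

theorem card_blocks_mul (h : IsQuasiSymmetricPair N B k lam x y) (hr : ∀ p, ∑ β, N p β = r) :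
    (Fintype.card Q : ℝ) * k = Fintype.card P * r := by
  have h1 : ∑ β, ∑ p, N p β = ∑ p, ∑ β, N p β := Finset.sum_comm
  simpa [h.sum_points, hr] using h1

/-- Double counting of the pairs `(p, γ)` with `p` on both `β` and `γ`: there are `kr` of them, and
`γ = β` accounts for `k`. -/
theorem block_degree [DecidableEq Q] (h : IsQuasiSymmetricPair N B k lam x y)
    (hr : ∀ p, ∑ β, N p β = r) (hxy : y - x ≠ 0) (β : Q) :
    ∑ γ, B β γ = ((r - 1) * k - x * ((Fintype.card Q : ℝ) - 1)) / (y - x) := by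
  have h1 : ∑ γ, ∑ p, N p β * N p γ = k * r := by
    rw [Finset.sum_comm, ← h.sum_points β, Finset.sum_mul]
    exact Finset.sum_congr rfl fun p _ => by rw [← Finset.mul_sum, hr]
  simp only [h.block_gram, Finset.sum_add_distrib, Finset.sum_ite_eq, Finset.mem_univ, if_true,
    Finset.sum_const, Finset.card_univ, nsmul_eq_mul, ← Finset.mul_sum] at h1
  rw [eq_div_iff hxy]
  linear_combination h1

/-- The number of blocks through `p` that are adjacent to `β` in the block graph. -/
theorem sum_incidence_mul_adj [DecidableEq P] [DecidableEq Q]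
    (h : IsQuasiSymmetricPair N B k lam x y)
    (hr : ∀ p, ∑ β, N p β = r) (hxy : y - x ≠ 0) (p : P) (β : Q) :
    ∑ γ, N p γ * B γ β = (r - lam - k + x) / (y - x) * N p β + (lam * k - x * r) / (y - x) := by
  -- The triple product `N Nᵀ N` is evaluated here through `N Nᵀ` and afterwards through `Nᵀ N`,
  -- which is affine in `B`; comparison isolates `N B`.
  have h1 : ∑ γ, N p γ * ∑ q, N q γ * N q β = lam * k + (r - lam) * N p β := by
    calc ∑ γ, N p γ * ∑ q, N q γ * N q β = ∑ q, (∑ γ, N p γ * N q γ) * N q β := by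
          simp only [Finset.mul_sum, Finset.sum_mul]
          rw [Finset.sum_comm]
          simp only [mul_assoc]
      _ = lam * k + (r - lam) * N p β := by
          simp only [h.point_gram hr, add_mul, Finset.sum_add_distrib, ← Finset.mul_sum,
            h.sum_points, ite_mul, zero_mul, Finset.sum_ite_eq, Finset.mem_univ, if_true]
  simp only [h.block_gram, mul_add, Finset.sum_add_distrib, mul_ite, mul_zero,
    Finset.sum_ite_eq', Finset.mem_univ, if_true, ← Finset.sum_mul, hr,
    mul_left_comm _ (y - x), ← Finset.mul_sum] at h1
  field_simp
  linear_combination h1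

/-- The block graph is strongly regular: the number of common neighbours of two blocks. -/
theorem sum_adj_mul_adj [DecidableEq P] [DecidableEq Q]
    (h : IsQuasiSymmetricPair N B k lam x y)
    (hr : ∀ p, ∑ β, N p β = r) (hxy : y - x ≠ 0) {a ρ₁ ρ₂ : ℝ} (ha : ∀ β, ∑ γ, B β γ = a)
    (hρ₁ : ρ₁ = (r - lam - k + x) / (y - x)) (hρ₂ : ρ₂ = (x - k) / (y - x)) (β δ : Q) :
    ∑ γ, B β γ * B γ δ =
      a + ρ₁ * ρ₂ + (ρ₁ + ρ₂) * B β δ - if β = δ then ρ₁ * ρ₂ else 0 := by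
  set κ := (lam * k - x * r) / (y - x) with hκ
  have key : ∀ δ, (y - x) * ∑ γ, B β γ * B γ δ =
      ρ₁ * (∑ p, N p β * N p δ) + κ * k - x * a - (k - x) * B β δ := by
    intro δ
    have h1 : ∑ γ, B β γ * ∑ p, N p γ * N p δ = ρ₁ * (∑ p, N p β * N p δ) + κ * k := by
      calc ∑ γ, B β γ * ∑ p, N p γ * N p δ = ∑ p, (∑ γ, N p γ * B γ β) * N p δ := by
            simp only [Finset.mul_sum, Finset.sum_mul]
            rw [Finset.sum_comm]
            refine Finset.sum_congr rfl fun p _ => Finset.sum_congr rfl fun γ _ => ?_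
            rw [h.symm_B β γ]
            ring
        _ = ρ₁ * (∑ p, N p β * N p δ) + κ * k := by
            simp only [h.sum_incidence_mul_adj hr hxy, ← hρ₁, ← hκ, add_mul,
              Finset.sum_add_distrib, mul_assoc, ← Finset.mul_sum, h.sum_points]
    rw [← h1]
    simp only [h.block_gram, mul_add, Finset.sum_add_distrib, mul_ite, mul_zero,
      Finset.sum_ite_eq', Finset.mem_univ, if_true, ← Finset.sum_mul, ha,
      mul_left_comm _ (y - x), ← Finset.mul_sum]
    ring
  have hdiag : ∑ γ, B β γ * B γ β = a := by
    rw [← ha β]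
    exact Finset.sum_congr rfl fun γ _ => by rw [h.symm_B γ β, h.sq_B]
  -- The diagonal of `B²` is already known to be `a`. Subtracting this equation from the
  -- off-diagonal one eliminates the constant `κ * k - x * a`.
  have h2 := key β
  rw [hdiag, h.block_gram, h.diag_B, if_pos rfl] at h2
  have hρ₂' : (y - x) * ρ₂ = x - k := by rw [hρ₂]; field_simp
  by_cases hβδ : β = δ
  · subst hβδ
    rw [hdiag, h.diag_B, if_pos rfl]
    ring
  · have h3 := key δ
    rw [h.block_gram, if_neg hβδ] at h3
    rw [if_neg hβδ]
    apply mul_left_cancel₀ hxy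
    linear_combination h3 - h2 - (ρ₁ + B β δ) * hρ₂'

end IsQuasiSymmetricPair

/-! ### From the graph to its incidence and adjacency matrices -/

theorem Set.cast_ncard_setOf {α : Type*} [Fintype α] (R : α → Prop) [DecidablePred R] :
    ((({a | R a} : Set α).ncard : ℕ) : ℝ) = ∑ a, if R a then 1 else 0 := by
  rw [Set.ncard_eq_toFinset_card', Finset.sum_boole]
  simp

theorem sum_eq_sum_subtype_add_sum_subtype_of_compl {V : Type*} [Fintype V] {V₁ V₂ : Set V}
    [Fintype V₁] [Fintype V₂] (h : V₂ = V₁ᶜ) (f : V → ℝ) :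
    ∑ z, f z = ∑ p : V₁, f p + ∑ β : V₂, f β := by
  classical
  subst h
  rw [← (Equiv.Set.sumCompl V₁).sum_comp, Fintype.sum_sum_type]
  simp

theorem IsBiregularWithPartition.eq_compl {V : Type*} [Fintype V] {G : SimpleGraph V}
    [DecidableRel G.Adj] {V₁ V₂ : Set V} (h : IsBiregularWithPartition G V₁ V₂) : V₂ = V₁ᶜ := by
  obtain ⟨-, -, hU, k₁, k₂, hne, h₁, h₂⟩ := h
  ext u
  have hu : u ∈ V₁ ∪ V₂ := hU ▸ Set.mem_univ u
  constructor
  · intro hu2 hu1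
    rw [h₁] at hu1
    rw [h₂] at hu2
    exact hne (hu1.symm.trans hu2)
  · intro hu1
    exact hu.resolve_left hu1

/-- A graph whose edges between points and blocks form a quasi-symmetric design and whose blocks
carry the block graph yields a pair of matrices with the corresponding sums. -/
theorem IsQuasiSymmetricDesign.isQuasiSymmetricPair {V : Type*}
    {G : SimpleGraph V} [DecidableRel G.Adj] {V₁ V₂ : Set V} [Fintype V₁] [Fintype V₂]
    {v k lam x y : ℕ}
    (hD : IsQuasiSymmetricDesign (edgeIncidence G V₁ V₂) v k lam x y)
    (hG₂ : G.induce V₂ = blockGraph (edgeIncidence G V₁ V₂) y) :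
    IsQuasiSymmetricPair (fun (p : V₁) (β : V₂) => G.adjMatrix ℝ p β)
      (fun (β γ : V₂) => G.adjMatrix ℝ β γ) k lam x y where
  sq_N p β := by simp [SimpleGraph.adjMatrix_apply]
  sq_B β γ := by simp [SimpleGraph.adjMatrix_apply]
  symm_B β γ := by simp [SimpleGraph.adjMatrix_apply, G.adj_comm]
  diag_B β := by simp [SimpleGraph.adjMatrix_apply]
  sum_points β := by
    rw [← hD.card_block β]
    simp only [edgeIncidence, Set.cast_ncard_setOf, SimpleGraph.adjMatrix_apply]
  sum_blocks_through p q hpq := by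
    rw [← hD.card_blocks_through p q hpq]
    simp only [edgeIncidence, Set.cast_ncard_setOf, SimpleGraph.adjMatrix_apply, ite_and, ite_mul,
      one_mul, zero_mul]
  inter β γ hβγ := by
    have hsum : ∑ p : V₁, G.adjMatrix ℝ p β * G.adjMatrix ℝ p γ =
        (({p : V₁ | edgeIncidence G V₁ V₂ p β ∧ edgeIncidence G V₁ V₂ p γ}.ncard : ℕ) : ℝ) := by
      simp only [edgeIncidence, Set.cast_ncard_setOf, SimpleGraph.adjMatrix_apply, ite_and, ite_mul,
        one_mul, zero_mul]
    have hadj : G.Adj β γ ↔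
        {p : V₁ | edgeIncidence G V₁ V₂ p β ∧ edgeIncidence G V₁ V₂ p γ}.ncard = y := by
      have : (G.induce V₂).Adj β γ ↔ (blockGraph (edgeIncidence G V₁ V₂) y).Adj β γ := by
        rw [hG₂]
      simpa [blockGraph, hβγ] using this
    rw [hsum, SimpleGraph.adjMatrix_apply]
    rcases hD.inter β γ hβγ with h | h
    · have hn : ¬ G.Adj β γ := fun hc => hD.x_ne_y (h.symm.trans (hadj.1 hc))
      simp [hn, h]
    · simp [hadj.2 h, h]

/-- If all incidences held, every intersection would be the whole point set, forcing `x = y`. Such a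
pair is needed to extract the sixth equation. -/
theorem IsQuasiSymmetricDesign.exists_not_incident {P B : Type*} {I : P → B → Prop}
    {v k lam x y : ℕ} (hD : IsQuasiSymmetricDesign I v k lam x y) : ∃ p β, ¬ I p β := by
  by_contra! hcon
  obtain ⟨β, γ, -, hx⟩ := hD.exists_x
  obtain ⟨β', γ', -, hy⟩ := hD.exists_y
  simp only [hcon, and_self] at hx hy
  exact hD.x_ne_y (hx.symm.trans hy)

theorem IsTwoDesign.exists_incident {P B : Type*} {I : P → B → Prop}
    {v k lam : ℕ} (hD : IsTwoDesign I v k lam) (β : B) : ∃ p, I p β := by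
  by_contra! hcon
  have h := hD.card_block β
  simp only [hcon, Set.ofPred_false, Set.ncard_empty] at h
  have := hD.two_le_k
  omega

/-- Two points share a block because `lam` is positive, and every block contains a point. -/
theorem connected_of_isTwoDesign {V : Type*} {G : SimpleGraph V} {V₁ V₂ : Set V}
    (hV : V₂ = V₁ᶜ) (hne : V₁.Nonempty) {v k lam : ℕ}
    (hD : IsTwoDesign (edgeIncidence G V₁ V₂) v k lam) : G.Connected := by
  obtain ⟨p₀, hp₀⟩ := hne
  have hpt : ∀ p ∈ V₁, G.Reachable p p₀ := by
    intro p hp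
    by_cases hpp : p = p₀
    · rw [hpp]
    · have h := hD.card_blocks_through ⟨p, hp⟩ ⟨p₀, hp₀⟩ (by simpa using hpp)
      have hpos := hD.lam_pos
      obtain ⟨β, hβ⟩ := Set.nonempty_of_ncard_ne_zero (h.trans_ne hpos.ne')
      exact (SimpleGraph.Adj.reachable hβ.1).trans (SimpleGraph.Adj.reachable hβ.2).symm
  have hall : ∀ u, G.Reachable u p₀ := by
    intro u
    by_cases hu : u ∈ V₁
    · exact hpt u hu
    · have hu2 : u ∈ V₂ := by rw [hV]; exact hu
      obtain ⟨p, hp⟩ := hD.exists_incident ⟨u, hu2⟩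
      exact (SimpleGraph.Adj.reachable hp).symm.trans (hpt p p.2)
  have : Nonempty V := ⟨p₀⟩
  exact ⟨fun u w => (hall u).trans (hall w).symm⟩

/-! ### Entries by type of pair and the seven equations -/

theorem proposition5p3 {V : Type*} [Fintype V] [DecidableEq V]
    (G : SimpleGraph V) [DecidableRel G.Adj] (V₁ V₂ : Set V)
    (hG : IsBiregularWithPartition G V₁ V₂)
    (hG₁ : G.induce V₁ = ⊥)
    (v k lam x y : ℕ)
    (hD : IsQuasiSymmetricDesign (edgeIncidence G V₁ V₂) v k lam x y)
    (hG₂ : G.induce V₂ = blockGraph (edgeIncidence G V₁ V₂) y)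
    -- the derived parameters of the design and of its block graph
    (r b a ρ₁ ρ₂ c d : ℝ)
    (hr : r = (lam : ℝ) * ((v : ℝ) - 1) / ((k : ℝ) - 1))
    (hb : b = (v : ℝ) * r / (k : ℝ))
    (ha : a = ((r - 1) * (k : ℝ) - (x : ℝ) * (b - 1)) / ((y : ℝ) - (x : ℝ)))
    (hρ₁ : ρ₁ = (r - (lam : ℝ) - (k : ℝ) + (x : ℝ)) / ((y : ℝ) - (x : ℝ)))
    (hρ₂ : ρ₂ = ((x : ℝ) - (k : ℝ)) / ((y : ℝ) - (x : ℝ)))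
    (hd : d = a + ρ₁ * ρ₂)
    (hc : c = d + ρ₁ + ρ₂)
    (θ₁ θ₂ t : ℝ)
    (ht : t = θ₁ * θ₂ / ((v : ℝ) * r + b * ((k : ℝ) + a))) :
    HasThreeLEigenvalues G θ₁ θ₂ ↔
      (r / (k + a) = t * r ^ 2 - (θ₁ - 1) * (θ₂ - 1) * r ∧
       lam / (k + a) = t * r ^ 2 ∧
       k / r + a / (k + a) = t * (k + a) ^ 2 - (θ₁ - 1) * (θ₂ - 1) * (k + a) ∧
       x / r + d / (k + a) = t * (k + a) ^ 2 ∧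
       y / r + c / (k + a) = t * (k + a) ^ 2 + 2 - θ₁ - θ₂ ∧
       ((lam : ℝ) * k - x * r) / (((y : ℝ) - x) * (k + a)) = t * r * (k + a) ∧
       (((lam : ℝ) - 1) * ((k : ℝ) - 1) - ((x : ℝ) - 1) * (r - 1)) / (((y : ℝ) - x) * (k + a))
         = t * r * (k + a) + 2 - θ₁ - θ₂) := by
  classical
  let : Fintype V₁ := Fintype.ofFinite _
  let : Fintype V₂ := Fintype.ofFinite _
  have hV := hG.eq_compl
  have hsplit := sum_eq_sum_subtype_add_sum_subtype_of_compl (V₁ := V₁) (V₂ := V₂) hV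
  have hQ := hD.isQuasiSymmetricPair hG₂
  have hconn := connected_of_isTwoDesign hV hG.1 hD.toIsTwoDesign
  have hk2 := hD.two_le_k
  have hkv := hD.k_le_v
  have hxy : (y : ℝ) - x ≠ 0 := sub_ne_zero.2 (by exact_mod_cast hD.x_ne_y.symm)
  have hk1 : (k : ℝ) - 1 ≠ 0 := by
    have : (2 : ℝ) ≤ k := by exact_mod_cast hk2
    linarith
  have hk0 : (k : ℝ) ≠ 0 := by positivity
  have hcard : Fintype.card V₁ = v := by rw [← hD.card_points, Nat.card_eq_fintype_card]
  have hrow : ∀ p : V₁, ∑ β : V₂, G.adjMatrix ℝ p β = r := fun p => by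
    rw [hr, ← hcard]; exact hQ.replication hk1 p
  have hbcard : (Fintype.card V₂ : ℝ) = b := by
    rw [hb, eq_div_iff hk0, ← hcard]; exact hQ.card_blocks_mul hrow
  have hadeg : ∀ β : V₂, ∑ γ : V₂, G.adjMatrix ℝ β γ = a := fun β => by
    rw [ha, ← hbcard]; exact hQ.block_degree hrow hxy β
  have h11 : ∀ p q : V₁, G.adjMatrix ℝ p q = 0 := by
    intro p q
    have h : ¬ (G.induce V₁).Adj p q := by rw [hG₁]; simp
    have h' : ¬ G.Adj p q := by simpa using h
    simp [SimpleGraph.adjMatrix_apply, h']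
  have hsymm : ∀ u w, G.adjMatrix ℝ u w = G.adjMatrix ℝ w u := fun u w => by
    simp [SimpleGraph.adjMatrix_apply, G.adj_comm]
  have hdegsum : ∀ u, (G.degree u : ℝ) = ∑ z, G.adjMatrix ℝ u z := fun u => by
    simp only [SimpleGraph.adjMatrix_apply]
    exact G.degree_eq_sum_if_adj u
  have hdeg1 : ∀ p : V₁, (G.degree p : ℝ) = r := fun p => by
    rw [hdegsum, hsplit, hrow]
    simp only [h11, Finset.sum_const_zero, zero_add]
  have hdeg2 : ∀ β : V₂, (G.degree β : ℝ) = k + a := fun β => by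
    rw [hdegsum, hsplit, hadeg, ← hQ.sum_points β]
    simp only [hsymm β]
  have hlam : (0 : ℝ) < lam := by exact_mod_cast hD.lam_pos
  have hrpos : 0 < r := by
    have h2 : (2 : ℝ) ≤ k := by exact_mod_cast hk2
    have h3 : (k : ℝ) ≤ v := by exact_mod_cast hkv
    rw [hr]
    exact div_pos (mul_pos hlam (by linarith)) (by linarith)
  obtain ⟨β₁, γ₁, hβγ₁, hx₁⟩ := hD.exists_x
  obtain ⟨β₂, γ₂, hβγ₂, hy₂⟩ := hD.exists_y
  -- Nonnegativity of `a` comes from its meaning as a valency in the block graph, not from its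
  -- formula.
  have hkapos : 0 < (k : ℝ) + a := by
    have h0 : 0 ≤ a := by
      rw [← hadeg β₁]
      exact Finset.sum_nonneg fun γ _ => by
        rw [SimpleGraph.adjMatrix_apply]; split_ifs <;> norm_num
    positivity
  have hdegpos : ∀ u, 0 < G.degree u := by
    intro u
    by_cases hu : u ∈ V₁
    · have := hdeg1 ⟨u, hu⟩
      rw [← Nat.cast_pos (α := ℝ)]; simpa [this] using hrpos
    · have hu2 : u ∈ V₂ := by rw [hV]; exact hu
      have := hdeg2 ⟨u, hu2⟩
      rw [← Nat.cast_pos (α := ℝ)]; simpa [this] using hkapos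
  -- The denominator of `t` is the sum of all valencies.
  have hS : ∑ z, (G.degree z : ℝ) = v * r + b * (k + a) := by
    rw [hsplit]
    simp only [hdeg1, hdeg2, Finset.sum_const, Finset.card_univ, nsmul_eq_mul, hcard, hbcard]
  obtain ⟨p₀, q₀, hpq⟩ : ∃ p q : V₁, p ≠ q := by
    apply Fintype.one_lt_card_iff.1
    omega
  have hnadj : ¬ G.Adj p₀ q₀ := fun h => by simpa [SimpleGraph.adjMatrix_apply, h] using h11 p₀ q₀
  rw [hasThreeLEigenvalues_iff G hdegpos hconn (Subtype.coe_ne_coe.2 hpq) hnadj, hS, ← ht]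
  -- the entries of `A D⁻¹ A`
  have s11 : ∀ p q : V₁, ∑ z, G.adjMatrix ℝ p z * G.adjMatrix ℝ z q / G.degree z =
      (lam + if p = q then r - lam else 0) / (k + a) := by
    intro p q
    rw [hsplit, ← hQ.point_gram hrow, Finset.sum_div]
    simp only [h11, hdeg2, zero_mul, zero_div, Finset.sum_const_zero, zero_add]
    exact Finset.sum_congr rfl fun β _ => by rw [hsymm β q]
  have s12 : ∀ (p : V₁) (β : V₂), ∑ z, G.adjMatrix ℝ p z * G.adjMatrix ℝ z β / G.degree z =
      (ρ₁ * G.adjMatrix ℝ p β + (lam * k - x * r) / (y - x)) / (k + a) := by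
    intro p β
    rw [hsplit, hρ₁, ← hQ.sum_incidence_mul_adj hrow hxy, Finset.sum_div]
    simp only [h11, hdeg2, zero_mul, zero_div, Finset.sum_const_zero, zero_add]
  have s22 : ∀ β γ : V₂, ∑ z, G.adjMatrix ℝ β z * G.adjMatrix ℝ z γ / G.degree z =
      (x + (y - x) * G.adjMatrix ℝ β γ + if β = γ then (k : ℝ) - x else 0) / r +
      (d + (ρ₁ + ρ₂) * G.adjMatrix ℝ β γ - if β = γ then ρ₁ * ρ₂ else 0) / (k + a) := by
    intro β γ
    rw [hsplit, hd, ← hQ.block_gram, ← hQ.sum_adj_mul_adj hrow hxy hadeg hρ₁ hρ₂, Finset.sum_div,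
      Finset.sum_div]
    simp only [hdeg1, hdeg2]
    congr 1
    exact Finset.sum_congr rfl fun p _ => by rw [hsymm β p]
  have hne₁₂ : ∀ (p : V₁) (β : V₂), (p : V) ≠ β := fun p β h => by
    have h2 : (β : V) ∈ V₁ᶜ := hV ▸ β.2
    exact h2 (h ▸ p.2)
  -- The left sides of the last two equations are the values of `s12` at adjacency entry 1 and 0.
  have hentry : (((lam : ℝ) - 1) * ((k : ℝ) - 1) - ((x : ℝ) - 1) * (r - 1)) /
      (((y : ℝ) - x) * (k + a)) = (ρ₁ * 1 + (lam * k - x * r) / (y - x)) / (k + a) := by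
    rw [hρ₁]
    field_simp
    ring
  have hentry' : ((lam : ℝ) * k - x * r) / (((y : ℝ) - x) * (k + a)) =
      (ρ₁ * 0 + (lam * k - x * r) / (y - x)) / (k + a) := by
    field_simp
    ring
  constructor
  · rintro ⟨-, -, h⟩
    -- One representative of each of the seven types of pair yields the seven equations.
    obtain ⟨p₁, δ₁, hnI⟩ := hD.exists_not_incident
    obtain ⟨p₂, hI⟩ := hD.exists_incident β₁
    have hA₁ : G.adjMatrix ℝ p₁ δ₁ = 0 := by
      rw [SimpleGraph.adjMatrix_apply]
      exact if_neg hnI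
    have hA₂ : G.adjMatrix ℝ p₂ β₁ = 1 := by
      rw [SimpleGraph.adjMatrix_apply]
      exact if_pos hI
    have hB₁ : G.adjMatrix ℝ β₁ γ₁ = 0 := by
      rw [SimpleGraph.adjMatrix_apply, if_neg]
      intro hadj
      have : (G.induce V₂).Adj β₁ γ₁ := hadj
      rw [hG₂] at this
      exact hD.x_ne_y (hx₁.symm.trans this.2)
    have hB₂ : G.adjMatrix ℝ β₂ γ₂ = 1 := by
      rw [SimpleGraph.adjMatrix_apply, if_pos]
      have : (G.induce V₂).Adj β₂ γ₂ := by
        rw [hG₂]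
        exact ⟨hβγ₂, hy₂⟩
      exact this
    have e1 := h p₀ p₀
    have e2 := h p₀ q₀
    have e3 := h β₁ β₁
    have e4 := h β₁ γ₁
    have e5 := h β₂ γ₂
    have e6 := h p₁ δ₁
    have e7 := h p₂ β₁
    rw [s11, h11, if_pos rfl, if_pos rfl, hdeg1] at e1
    rw [s11, h11, if_neg hpq, if_neg (Subtype.coe_ne_coe.2 hpq), hdeg1, hdeg1] at e2
    rw [s22, hQ.diag_B, if_pos rfl, if_pos rfl, if_pos rfl, hdeg2] at e3
    rw [s22, hB₁, if_neg hβγ₁, if_neg hβγ₁, if_neg (Subtype.coe_ne_coe.2 hβγ₁), hdeg2, hdeg2] at e4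
    rw [s22, hB₂, if_neg hβγ₂, if_neg hβγ₂, if_neg (Subtype.coe_ne_coe.2 hβγ₂), hdeg2, hdeg2] at e5
    rw [s12, hA₁, if_neg (hne₁₂ _ _), hdeg1, hdeg2] at e6
    rw [s12, hA₂, if_neg (hne₁₂ _ _), hdeg1, hdeg2] at e7
    rw [hentry', hentry]
    refine ⟨?_, ?_, ?_, ?_, ?_, ?_, ?_⟩
    · linear_combination e1
    · linear_combination e2
    · linear_combination e3 - hd / (k + a)
    · linear_combination e4
    · linear_combination e5 + hc / (k + a)
    · linear_combination e6
    · linear_combination e7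
  · rw [hentry', hentry]
    rintro ⟨e1, e2, e3, e4, e5, e6, e7⟩
    -- Since `lam` is positive, the second equation forces `t ≠ 0`, so neither eigenvalue parameter
    -- vanishes.
    have ht0 : t ≠ 0 := by
      rintro rfl
      rw [zero_mul] at e2
      exact (div_pos hlam hkapos).ne' e2
    have hθ : θ₁ * θ₂ ≠ 0 := by
      intro h0
      rw [h0, zero_div] at ht
      exact ht0 ht
    refine ⟨left_ne_zero_of_mul hθ, right_ne_zero_of_mul hθ, ?_⟩
    have h01 : ∀ u w, G.adjMatrix ℝ u w = 0 ∨ G.adjMatrix ℝ u w = 1 := fun u w => by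
      rw [SimpleGraph.adjMatrix_apply]
      split_ifs <;> simp
    have hcases : ∀ u : V, (∃ p : V₁, u = p) ∨ ∃ β : V₂, u = β := by
      intro u
      by_cases hu : u ∈ V₁
      · exact Or.inl ⟨⟨u, hu⟩, rfl⟩
      · exact Or.inr ⟨⟨u, by rw [hV]; exact hu⟩, rfl⟩
    have h12 : ∀ (p : V₁) (β : V₂),
        (ρ₁ * G.adjMatrix ℝ p β + (lam * k - x * r) / (y - x)) / (k + a) -
          (2 - θ₁ - θ₂) * G.adjMatrix ℝ p β + 0 = t * r * (k + a) := by
      intro p β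
      rcases h01 p β with hA | hA <;> rw [hA]
      · linear_combination e6
      · linear_combination e7
    intro u w
    rcases hcases u with ⟨p, rfl⟩ | ⟨β, rfl⟩ <;> rcases hcases w with ⟨q, rfl⟩ | ⟨γ, rfl⟩
    · rw [s11, h11, hdeg1, hdeg1]
      by_cases hpq' : p = q
      · rw [if_pos hpq', if_pos (congrArg _ hpq')]
        linear_combination e1
      · rw [if_neg hpq', if_neg (Subtype.coe_ne_coe.2 hpq')]
        linear_combination e2
    · rw [s12, if_neg (hne₁₂ _ _), hdeg1, hdeg2, h12]
    -- The matrix `A D⁻¹ A` is symmetric, so block-point entries reduce to point-block ones.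
    · have hcomm : ∑ z, G.adjMatrix ℝ β z * G.adjMatrix ℝ z q / G.degree z =
          ∑ z, G.adjMatrix ℝ q z * G.adjMatrix ℝ z β / G.degree z :=
        Finset.sum_congr rfl fun z _ => by rw [hsymm β z, hsymm z q, mul_comm]
      rw [hcomm, hsymm β q, s12, if_neg (hne₁₂ _ _).symm, hdeg1, hdeg2, h12]
      ring
    · rw [s22, hdeg2, hdeg2]
      by_cases hβγ : β = γ
      · subst hβγ
        rw [hQ.diag_B, if_pos rfl, if_pos rfl, if_pos rfl]
        linear_combination e3 + hd / (k + a)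
      · rw [if_neg hβγ, if_neg hβγ, if_neg (Subtype.coe_ne_coe.2 hβγ)]
        rcases h01 β γ with hB | hB <;> rw [hB]
        · linear_combination e4
        · linear_combination e5 - hc / (k + a)
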